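/- Let $M\cong\mathbb Z^d$ be a lattice, $M_{\mathbb R}=M\otimes_{\mathbb Z}\mathbb R$. A lattice polytope is the convex hull of finitely many lattice points; a lattice polytope $P$ containing $0$ in its interior is called reflexive if $P^*=\{y : \langle y,x\rangle\ge -1 \text{ for all } x\in P\}$ is a lattice polytope with respect to the dual lattice. Let $\Delta_1,\dots,\Delta_r\subseteq M_{\mathbb R}$ be a proper centered nef-partition, i.e. lattice polytopes of positive dimension with $0\in\Delta_i$ for all $i$ whose Minkowski sum $\Delta_1+\cdots+\Delta_r$ is a ($d$-dimensional) reflexive polytope with $0$ in its interior. For $I\subseteq\{1,\dots,r\}$ put $\Delta^I=\sum_{i\in I}\Delta_i$. Call $I$ irreducible if it is minimal with respect to inclusion among the non-empty subsets for which $\Delta^I$ is reflexive in its linear span $\operatorname{lin}(\Delta^I)$, with respect to the lattice $M\cap\operatorname{lin}(\Delta^I)$. Then any two distinct irreducible subsets of $\{1,\dots,r\}$ are disjoint. Hence the decomposition of the nef-partition into irreducible nef-partitions is unique: there is exactly one partition $\{I_1,\dots,I_l\}$ of $\{1,\dots,r\}$ into irreducible subsets, and it satisfies $$\Delta_1+\cdots+\Delta_r=\Delta^{I_1}+\cdots+\Delta^{I_l},\qquad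 \operatorname{lin}(\Delta^{I_1})\oplus\cdots\oplus\operatorname{lin}(\Delta^{I_l})=M_{\mathbb R}.$$ -/

import Mathlib

open scoped Pointwise

namespace NefPartition

section Polytopes

variable {V : Type*} [AddCommGroup V] [Module ℝ V]

/-- A lattice polytope with respect to `L`: the convex hull of finitely many points of `L`. -/
def IsLatticePolytope (L : Submodule ℤ V) (P : Set V) : Prop :=
  ∃ S : Finset V, (S : Set V) ⊆ L ∧ P = convexHull ℝ (S : Set V)

/-- The dual lattice: the linear forms that take integral values on `L`. -/
def dualLattice (L : Submodule ℤ V) : Submodule ℤ (Module.Dual ℝ V) where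
  carrier := {y | ∀ x ∈ L, ∃ n : ℤ, y x = n}
  add_mem' := by
    intro a b ha hb x hx
    obtain ⟨m, hm⟩ := ha x hx
    obtain ⟨n, hn⟩ := hb x hx
    exact ⟨m + n, by simp [hm, hn]⟩
  zero_mem' := fun x _ => ⟨0, by simp⟩
  smul_mem' := by
    intro c a ha x hx
    obtain ⟨m, hm⟩ := ha x hx
    exact ⟨c * m, by simp [hm]⟩

/-- The dual polytope `{y : ⟨y, x⟩ ≥ -1 for all x ∈ P}`. -/
def dualPolytope (P : Set V) : Set (Module.Dual ℝ V) :=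
  {y | ∀ x ∈ P, -1 ≤ y x}

/-- The lattice `L ∩ U` in a linear subspace `U`. -/
def latticeIn (L : Submodule ℤ V) (U : Submodule ℝ V) : Submodule ℤ U :=
  L.comap (U.subtype.restrictScalars ℤ)

end Polytopes

section Nef

variable {V : Type*} [NormedAddCommGroup V] [NormedSpace ℝ V]

/-- A reflexive polytope: a lattice polytope with `0` in its interior whose dual polytope is a
lattice polytope with respect to the dual lattice. -/
structure IsReflexive (L : Submodule ℤ V) (P : Set V) : Prop where
  isLatticePolytope : IsLatticePolytope L P
  zero_mem_interior : (0 : V) ∈ interior P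
  isLatticePolytope_dual : IsLatticePolytope (dualLattice L) (dualPolytope P)

/-- `P` is a reflexive polytope in its linear span `U`, with respect to the lattice `L ∩ U`. -/
def IsReflexiveInSpan (L : Submodule ℤ V) (P : Set V) : Prop :=
  IsReflexive (latticeIn L (Submodule.span ℝ P))
    ((↑) ⁻¹' P : Set (Submodule.span ℝ P))

variable {ι : Type*}

/-- The Minkowski sum `Δ^I` of the polytopes `Δ i`, `i ∈ I`. -/
def partialSum (Δ : ι → Set V) (I : Finset ι) : Set V :=
  ∑ i ∈ I, Δ i

/-- A centered nef-partition: lattice polytopes containing `0` whose Minkowski sum is a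
(full-dimensional) reflexive polytope, with `0` as its interior lattice point. -/
structure IsCenteredNefPartition [Fintype ι] (L : Submodule ℤ V) (Δ : ι → Set V) : Prop where
  isLatticePolytope : ∀ i, IsLatticePolytope L (Δ i)
  zero_mem : ∀ i, (0 : V) ∈ Δ i
  isReflexive : IsReflexive L (partialSum Δ Finset.univ)

/-- The nef-partition is proper: every polytope has positive dimension. -/
def IsProper (Δ : ι → Set V) : Prop :=
  ∀ i, 0 < Module.finrank ℝ (vectorSpan ℝ (Δ i))

/-- An irreducible index set: minimal (for inclusion) among the non-empty `I` for which `Δ^I` is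
reflexive in its linear span. -/
def IsIrreducibleSubset (L : Submodule ℤ V) (Δ : ι → Set V) (I : Finset ι) : Prop :=
  Minimal (fun J : Finset ι => J.Nonempty ∧ IsReflexiveInSpan L (partialSum Δ J)) I

/-- A decomposition into irreducible nef-partitions: a partition of the index set into
irreducible subsets `I₁, …, I_l`, such that `Δ^{I₁} + ⋯ + Δ^{I_l}` is the whole Minkowski sum and
the ambient space is the (internal) direct sum of the linear spans of the `Δ^{I_j}`. -/
structure IsIrreducibleDecomposition [Fintype ι] [DecidableEq ι] (L : Submodule ℤ V)
    (Δ : ι → Set V) (D : Finpartition (Finset.univ : Finset ι)) : Prop where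
  irreducible : ∀ I ∈ D.parts, IsIrreducibleSubset L Δ I
  sum_eq : partialSum Δ Finset.univ = ∑ I ∈ D.parts, partialSum Δ I
  isInternal : DirectSum.IsInternal
    (fun I : D.parts => Submodule.span ℝ (partialSum Δ (I : Finset ι)))

end Nef

end NefPartition

/-! Let `h_j` be the support function of `Δ j`, with values `h_j(y) = max (-y)` over `Δ j`, and let
`S` be a finite set of dual lattice points whose hull is the dual of the whole Minkowski sum. For `s
∈ S` the `h_j(s)` are nonnegative integers with sum at most 1, so at most one is nonzero
(`supportFn_eq_zero_of_ne`). Moreover every `y` is a nonnegative combination of `S` along which all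
the `h_j` are additive (`exists_supportFn_eq_sum`), so questions about arbitrary linear forms reduce
to `S`.

Consequently `Δ^J` is reflexive in its span exactly when 0 is a relative interior point
(`isReflexiveInSpan_iff`), and this condition is stable under intersection and complement
(`isCentered_inter`, `isCentered_compl`). Irreducible sets are therefore the atoms of a Boolean
algebra of index sets: they are disjoint and cover everything. The spans of complementary members
meet only in 0, which gives the direct sum. -/

namespace NefPartition

/-! ### Support functions of lattice polytopes -/

section SupportFunction

variable {V : Type*} [AddCommGroup V] [Module ℝ V]

/-- The support function `y ↦ max_{x ∈ C} -⟨y, x⟩` of `C`. -/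
noncomputable def supportFn (C : Set V) (y : Module.Dual ℝ V) : ℝ :=
  sSup ((fun x => -y x) '' C)

lemma exists_isGreatest_convexHull {T : Finset V} (hT : T.Nonempty) (y : Module.Dual ℝ V) :
    ∃ t ∈ T, IsGreatest ((fun x => -y x) '' convexHull ℝ (T : Set V)) (-y t) := by
  obtain ⟨t, htT, ht⟩ := T.exists_min_image y hT
  refine ⟨t, htT, ⟨t, subset_convexHull ℝ _ htT, rfl⟩, ?_⟩
  rintro _ ⟨x, hx, rfl⟩
  have hsub : convexHull ℝ (T : Set V) ⊆ {x | y t ≤ y x} :=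
    convexHull_min (fun x hx => ht x hx) (convex_halfSpace_ge y.isLinear (y t))
  exact neg_le_neg (hsub hx)

variable {L : Submodule ℤ V} {C : Set V}

lemma IsLatticePolytope.exists_supportFn_eq (hC : IsLatticePolytope L C) (h0 : C.Nonempty)
    (y : Module.Dual ℝ V) :
    ∃ t ∈ C, t ∈ L ∧ supportFn C y = -y t ∧ ∀ x ∈ C, -y x ≤ supportFn C y := by
  obtain ⟨T, hTL, rfl⟩ := hC
  have hT : T.Nonempty := by
    rw [convexHull_nonempty_iff] at h0
    exact_mod_cast h0
  obtain ⟨t, htT, ht⟩ := exists_isGreatest_convexHull hT y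
  have hs : supportFn (convexHull ℝ (T : Set V)) y = -y t := ht.csSup_eq
  refine ⟨t, subset_convexHull ℝ _ htT, hTL htT, hs, fun x hx => ?_⟩
  rw [hs]
  exact ht.2 ⟨x, hx, rfl⟩

end SupportFunction

/-! ### Interior points tested by linear forms -/

section Topological

variable {V : Type*} [NormedAddCommGroup V] [NormedSpace ℝ V]

lemma eq_zero_of_nonneg_of_zero_mem_interior {C : Set V} (hC : (0 : V) ∈ interior C)
    {y : Module.Dual ℝ V} (hy : ∀ x ∈ C, 0 ≤ y x) : y = 0 := by
  have key : ∀ v : V, 0 ≤ y v := by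
    intro v
    have hcont : Filter.Tendsto (fun t : ℝ => t • v) (nhds 0) (nhds 0) := by
      have : Continuous fun t : ℝ => t • v := by fun_prop
      simpa using this.tendsto 0
    have hev := hcont.eventually (mem_interior_iff_mem_nhds.1 hC)
    obtain ⟨t, ht, hpos⟩ := ((hev.filter_mono nhdsWithin_le_nhds).and
      (self_mem_nhdsWithin (s := Set.Ioi (0 : ℝ)))).exists
    have := hy _ ht
    rw [map_smul, smul_eq_mul] at this
    exact nonneg_of_mul_nonneg_right this hpos
  ext v
  have h := key (-v)
  rw [map_neg] at h
  simpa using le_antisymm (by linarith) (key v)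

lemma zero_mem_interior_of_forall_nonneg [FiniteDimensional ℝ V] {C : Set V} (hC : Convex ℝ C)
    (h0 : (0 : V) ∈ C) (hspan : Submodule.span ℝ C = ⊤)
    (hdual : ∀ y : Module.Dual ℝ V, (∀ x ∈ C, 0 ≤ y x) → y = 0) : (0 : V) ∈ interior C := by
  -- Since `0 ∈ C`, the affine span of `C` is its linear span.
  have hne : (interior C).Nonempty := by
    rw [hC.interior_nonempty_iff_affineSpan_eq_top]
    simpa [Set.insert_eq_of_mem h0] using
      affineSpan_singleton_union_vadd_eq_top_of_span_eq_top (k := ℝ) (s := C) (0 : V)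
        (by simpa using hspan)
  by_contra hnot
  obtain ⟨f, hf⟩ := geometric_hahn_banach_open_point hC.interior isOpen_interior hnot
  have hle : ∀ x ∈ C, f x ≤ 0 := by
    intro x hx
    have hx' : x ∈ closure (interior C) := by
      rw [hC.closure_interior_eq_closure_of_nonempty_interior hne]
      exact subset_closure hx
    have : closure (interior C) ⊆ {x | f x ≤ 0} :=
      closure_minimal (fun a ha => by simpa using (hf a ha).le)
        (isClosed_le f.continuous continuous_const)
    exact this hx'
  have hf0 := hdual (-(f : V →ₗ[ℝ] ℝ)) (fun x hx => by simpa using hle x hx)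
  obtain ⟨a, ha⟩ := hne
  have h1 := hf a ha
  have h2 := LinearMap.congr_fun hf0 a
  simp at h1 h2
  linarith

end Topological

/-! ### Atoms of a Boolean algebra of finite sets -/

section Combinatorics

variable {α : Type*} [DecidableEq α]

/-- In a Boolean algebra of subsets of a finite set, every element lies in an atom. -/
lemma exists_minimal_mem [Fintype α] {G : Finset α → Prop} (huniv : G Finset.univ)
    (hinter : ∀ I J, G I → G J → G (I ∩ J)) (hcompl : ∀ I, G I → G Iᶜ) (a : α) :
    ∃ I, Minimal (fun J : Finset α => J.Nonempty ∧ G J) I ∧ a ∈ I := by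
  obtain ⟨I, hI⟩ := exists_minimal_of_wellFoundedLT (fun J : Finset α => a ∈ J ∧ G J)
    ⟨Finset.univ, Finset.mem_univ a, huniv⟩
  refine ⟨I, ⟨⟨⟨a, hI.prop.1⟩, hI.prop.2⟩, ?_⟩, hI.prop.1⟩
  rintro J ⟨⟨b, hb⟩, hJ⟩ hJI
  by_cases haJ : a ∈ J
  · exact hI.le_of_le ⟨haJ, hJ⟩ hJI
  -- If `J` misses `a`, then `I ∩ Jᶜ` still contains `a`, and minimality leaves no room for `J`
  -- inside `I`.
  · have hle : I ⊆ I ∩ Jᶜ := hI.le_of_le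
      ⟨Finset.mem_inter.2 ⟨hI.prop.1, Finset.mem_compl.2 haJ⟩, hinter _ _ hI.prop.2 (hcompl _ hJ)⟩
      Finset.inter_subset_left
    exact absurd hb (Finset.mem_compl.1 (Finset.mem_inter.1 (hle (hJI hb))).2)

lemma eq_of_minimal_of_mem {G : Finset α → Prop}
    (hinter : ∀ I J, G I → G J → G (I ∩ J)) {I J : Finset α}
    (hI : Minimal (fun J : Finset α => J.Nonempty ∧ G J) I)
    (hJ : Minimal (fun J : Finset α => J.Nonempty ∧ G J) J) {a : α} (haI : a ∈ I) (haJ : a ∈ J) :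
    I = J := by
  have h : (I ∩ J).Nonempty ∧ G (I ∩ J) :=
    ⟨⟨a, Finset.mem_inter.2 ⟨haI, haJ⟩⟩, hinter I J hI.prop.2 hJ.prop.2⟩
  exact (hI.eq_of_le h Finset.inter_subset_left).symm.trans
    (hJ.eq_of_le h Finset.inter_subset_right)

end Combinatorics

/-! ### Support functions of a nef-partition and centered index sets -/

section NefPartition

variable {V : Type*} [NormedAddCommGroup V] [NormedSpace ℝ V]
variable {ι : Type*} {L : Submodule ℤ V} {Δ : ι → Set V}

omit [NormedSpace ℝ V] in
lemma subset_partialSum (h0 : ∀ i, (0 : V) ∈ Δ i) {J : Finset ι} {j : ι} (hj : j ∈ J) :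
    Δ j ⊆ partialSum Δ J := by
  classical
  intro x hx
  refine (Set.mem_finsetSum _ _ _).2 ⟨fun i => if i = j then x else 0,
    fun {i} _ => ?_, by simp [hj]⟩
  dsimp only
  split_ifs with h
  · exact h ▸ hx
  · exact h0 i

omit [NormedSpace ℝ V] in
lemma partialSum_subset_partialSum (h0 : ∀ i, (0 : V) ∈ Δ i) {I J : Finset ι} (hIJ : I ⊆ J) :
    partialSum Δ I ⊆ partialSum Δ J := by
  intro x hx
  classical
  obtain ⟨g, hg, rfl⟩ := (Set.mem_finsetSum _ _ _).1 hx
  refine (Set.mem_finsetSum _ _ _).2 ⟨fun i => if i ∈ I then g i else 0, fun {i} _ => ?_, ?_⟩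
  · dsimp only
    split_ifs with h
    · exact hg h
    · exact h0 i
  · rw [← Finset.sum_filter, Finset.filter_mem_eq_inter, Finset.inter_eq_right.2 hIJ]

lemma apply_eq_zero_of_mem_span {J : Finset ι} {y : Module.Dual ℝ V}
    (hy : ∀ j ∈ J, ∀ x ∈ Δ j, y x = 0) {x : V} (hx : x ∈ Submodule.span ℝ (partialSum Δ J)) :
    y x = 0 := by
  have : Submodule.span ℝ (partialSum Δ J) ≤ LinearMap.ker y := by
    rw [Submodule.span_le]
    intro z hz
    obtain ⟨g, hg, rfl⟩ := (Set.mem_finsetSum _ _ _).1 hz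
    simp only [SetLike.mem_coe, LinearMap.mem_ker, map_sum]
    exact Finset.sum_eq_zero fun j hj => hy j hj _ (hg hj)
  exact this hx

/-- `0` is a relative interior point of `Δ^J`: no linear form supports `Δ^J` at `0`, except those
that vanish on it. -/
def IsCentered (Δ : ι → Set V) (J : Finset ι) : Prop :=
  ∀ y : Module.Dual ℝ V, (∀ j ∈ J, ∀ x ∈ Δ j, 0 ≤ y x) → ∀ j ∈ J, ∀ x ∈ Δ j, y x = 0

lemma IsReflexiveInSpan.isCentered (h0 : ∀ i, (0 : V) ∈ Δ i) {J : Finset ι}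
    (hJ : IsReflexiveInSpan L (partialSum Δ J)) : IsCentered Δ J := by
  intro y hy j hj x hx
  have hxP := subset_partialSum h0 hj hx
  have hz := eq_zero_of_nonneg_of_zero_mem_interior hJ.zero_mem_interior
    (y := y ∘ₗ (Submodule.span ℝ (partialSum Δ J)).subtype) (by
      rintro ⟨z, hzU⟩ hz
      obtain ⟨g, hg, hgz⟩ := (Set.mem_finsetSum _ _ _).1 hz
      change 0 ≤ y z
      change _ = z at hgz
      rw [← hgz, map_sum]
      exact Finset.sum_nonneg fun i hi => hy i hi _ (hg hi))
  exact LinearMap.congr_fun hz ⟨x, Submodule.subset_span hxP⟩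

variable [Fintype ι]

namespace IsCenteredNefPartition

variable (hΔ : IsCenteredNefPartition L Δ)
include hΔ

lemma neg_apply_le {j : ι} (y : Module.Dual ℝ V) {x : V} (hx : x ∈ Δ j) :
    -y x ≤ supportFn (Δ j) y := by
  obtain ⟨t, -, -, -, h⟩ := (hΔ.isLatticePolytope j).exists_supportFn_eq ⟨0, hΔ.zero_mem j⟩ y
  exact h x hx

lemma exists_neg_apply_eq (j : ι) (y : Module.Dual ℝ V) :
    ∃ x ∈ Δ j, supportFn (Δ j) y = -y x := by
  obtain ⟨t, ht, -, h, -⟩ := (hΔ.isLatticePolytope j).exists_supportFn_eq ⟨0, hΔ.zero_mem j⟩ y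
  exact ⟨t, ht, h⟩

lemma supportFn_nonneg (j : ι) (y : Module.Dual ℝ V) : 0 ≤ supportFn (Δ j) y := by
  simpa using hΔ.neg_apply_le y (hΔ.zero_mem j)

lemma exists_supportFn_eq_intCast (j : ι) {y : Module.Dual ℝ V} (hy : y ∈ dualLattice L) :
    ∃ n : ℤ, supportFn (Δ j) y = n := by
  obtain ⟨t, -, htL, h, -⟩ := (hΔ.isLatticePolytope j).exists_supportFn_eq ⟨0, hΔ.zero_mem j⟩ y
  obtain ⟨n, hn⟩ := hy t htL
  exact ⟨-n, by simp [h, hn]⟩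

lemma supportFn_eq_zero_iff {j : ι} {y : Module.Dual ℝ V} :
    supportFn (Δ j) y = 0 ↔ ∀ x ∈ Δ j, 0 ≤ y x := by
  constructor
  · intro h x hx
    have := hΔ.neg_apply_le y hx
    linarith
  · intro h
    obtain ⟨x, hx, he⟩ := hΔ.exists_neg_apply_eq j y
    exact le_antisymm (by linarith [h x hx]) (hΔ.supportFn_nonneg j y)

lemma supportFn_sum_le (j : ι) (S : Finset (Module.Dual ℝ V)) {w : Module.Dual ℝ V → ℝ}
    (hw : ∀ s ∈ S, 0 ≤ w s) :
    supportFn (Δ j) (∑ s ∈ S, w s • s) ≤ ∑ s ∈ S, w s * supportFn (Δ j) s := by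
  obtain ⟨x, hx, he⟩ := hΔ.exists_neg_apply_eq j (∑ s ∈ S, w s • s)
  rw [he, LinearMap.sum_apply, ← Finset.sum_neg_distrib]
  refine Finset.sum_le_sum fun s hs => ?_
  have := mul_le_mul_of_nonneg_left (hΔ.neg_apply_le s hx) (hw s hs)
  simpa using this

lemma mem_dualPolytope_partialSum_iff {J : Finset ι} {y : Module.Dual ℝ V} :
    y ∈ dualPolytope (partialSum Δ J) ↔ ∑ j ∈ J, supportFn (Δ j) y ≤ 1 := by
  constructor
  · intro h
    choose g hg he using fun j => hΔ.exists_neg_apply_eq j y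
    have := h (∑ j ∈ J, g j) ((Set.mem_finsetSum _ _ _).2 ⟨g, fun _ => hg _, rfl⟩)
    rw [map_sum] at this
    simp only [he, Finset.sum_neg_distrib]
    linarith
  · intro h x hx
    obtain ⟨g, hg, rfl⟩ := (Set.mem_finsetSum _ _ _).1 hx
    have := Finset.sum_le_sum fun j (hj : j ∈ J) => hΔ.neg_apply_le y (hg hj)
    rw [Finset.sum_neg_distrib] at this
    rw [map_sum]
    linarith

lemma eq_zero_of_nonneg {y : Module.Dual ℝ V} (hy : ∀ j, ∀ x ∈ Δ j, 0 ≤ y x) : y = 0 := by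
  refine eq_zero_of_nonneg_of_zero_mem_interior hΔ.isReflexive.zero_mem_interior fun x hx => ?_
  obtain ⟨g, hg, rfl⟩ := (Set.mem_finsetSum _ _ _).1 hx
  rw [map_sum]
  exact Finset.sum_nonneg fun j hj => hy j _ (hg hj)

lemma isCentered_univ : IsCentered Δ Finset.univ := by
  intro y hy j _ x _
  rw [hΔ.eq_zero_of_nonneg fun j => hy j (Finset.mem_univ j), LinearMap.zero_apply]

variable {S : Finset (Module.Dual ℝ V)}
  (hS : dualPolytope (partialSum Δ Finset.univ) = convexHull ℝ (S : Set (Module.Dual ℝ V)))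
include hS

lemma sum_supportFn_le_one {s : Module.Dual ℝ V} (hs : s ∈ S) :
    ∑ j, supportFn (Δ j) s ≤ 1 := by
  rw [← hΔ.mem_dualPolytope_partialSum_iff, hS]
  exact subset_convexHull ℝ _ hs

/-- All the support functions are simultaneously linear on suitable cones spanned by the
vertices of the dual polytope. -/
lemma exists_supportFn_eq_sum (y : Module.Dual ℝ V) :
    ∃ w : Module.Dual ℝ V → ℝ, (∀ s ∈ S, 0 ≤ w s) ∧ ∑ s ∈ S, w s • s = y ∧
      ∀ j, supportFn (Δ j) y = ∑ s ∈ S, w s * supportFn (Δ j) s := by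
  set H := ∑ j, supportFn (Δ j) y with hH
  have hH0 : 0 ≤ H := Finset.sum_nonneg fun j _ => hΔ.supportFn_nonneg j y
  obtain ⟨w, hw, hwH, hwy⟩ : ∃ w : Module.Dual ℝ V → ℝ, (∀ s ∈ S, 0 ≤ w s) ∧
      ∑ s ∈ S, w s = H ∧ ∑ s ∈ S, w s • s = y := by
    rcases hH0.eq_or_lt with h | h
    · have hy : y = 0 := hΔ.eq_zero_of_nonneg fun j => hΔ.supportFn_eq_zero_iff.1
        ((Finset.sum_eq_zero_iff_of_nonneg fun j _ => hΔ.supportFn_nonneg j y).1 h.symm j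
          (Finset.mem_univ j))
      exact ⟨0, by simp, by simp [← h], by simp [hy]⟩
    · have hmem : H⁻¹ • y ∈ dualPolytope (partialSum Δ Finset.univ) := by
        intro x hx
        obtain ⟨g, hg, rfl⟩ := (Set.mem_finsetSum _ _ _).1 hx
        have h1 := Finset.sum_le_sum fun j (hj : j ∈ Finset.univ) => hΔ.neg_apply_le y (hg hj)
        rw [Finset.sum_neg_distrib, ← map_sum, ← hH] at h1
        have h2 := mul_le_mul_of_nonneg_left h1 (inv_nonneg.2 hH0)
        rw [inv_mul_cancel₀ h.ne'] at h2
        rw [LinearMap.smul_apply, smul_eq_mul]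
        linarith
      rw [hS, Finset.mem_convexHull'] at hmem
      obtain ⟨w, hw, hw1, hwy⟩ := hmem
      refine ⟨fun s => H * w s, fun s hs => mul_nonneg hH0 (hw s hs), ?_, ?_⟩
      · rw [← Finset.mul_sum, hw1, mul_one]
      · simp only [mul_smul]
        rw [← Finset.smul_sum, hwy, smul_inv_smul₀ h.ne']
  refine ⟨w, hw, hwy, ?_⟩
  -- Subadditivity bounds each term, while the sums over `j` agree because the weights add up to
  -- `H`; so every inequality is an equality.
  have hle : ∀ j ∈ Finset.univ, supportFn (Δ j) y ≤ ∑ s ∈ S, w s * supportFn (Δ j) s := by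
    intro j _
    rw [← hwy]
    exact hΔ.supportFn_sum_le j S hw
  have hge : ∑ j, ∑ s ∈ S, w s * supportFn (Δ j) s ≤ H := by
    rw [Finset.sum_comm, ← hwH]
    refine Finset.sum_le_sum fun s hs => ?_
    rw [← Finset.mul_sum]
    exact mul_le_of_le_one_right (hw s hs) (hΔ.sum_supportFn_le_one hS hs)
  intro j
  exact (Finset.sum_eq_sum_iff_of_le hle).1 (le_antisymm (Finset.sum_le_sum hle) hge) j
    (Finset.mem_univ j)

lemma eq_zero_of_forall_apply_eq_zero {x : V} (hx : ∀ s ∈ S, s x = 0) : x = 0 := by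
  rw [← Module.forall_dual_apply_eq_zero_iff ℝ]
  intro y
  obtain ⟨w, -, rfl, -⟩ := hΔ.exists_supportFn_eq_sum hS y
  simp only [LinearMap.sum_apply, LinearMap.smul_apply]
  exact Finset.sum_eq_zero fun s hs => by rw [hx s hs, smul_zero]

/-- If `h_i(y) = 0`, additivity with nonnegative terms forces `h_i(s) = 0` for each `s` of positive
weight in `y`. -/
lemma isCentered_iff {J : Finset ι} :
    IsCentered Δ J ↔ ∀ s ∈ S, (∀ j ∈ J, supportFn (Δ j) s = 0) → ∀ j ∈ J, ∀ x ∈ Δ j, s x = 0 := by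
  constructor
  · intro h s _ hs
    exact h s fun j hj => hΔ.supportFn_eq_zero_iff.1 (hs j hj)
  · intro h y hy j hj x hx
    obtain ⟨w, hw, hwy, hsup⟩ := hΔ.exists_supportFn_eq_sum hS y
    rw [← hwy, LinearMap.sum_apply]
    refine Finset.sum_eq_zero fun s hs => ?_
    rcases eq_or_ne (w s) 0 with h0 | h0
    · simp [h0]
    · rw [LinearMap.smul_apply, h s hs (fun i hi => ?_) j hj x hx, smul_zero]
      have h1 := hsup i
      rw [hΔ.supportFn_eq_zero_iff.2 (hy i hi), eq_comm, Finset.sum_eq_zero_iff_of_nonneg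
        fun s hs => mul_nonneg (hw s hs) (hΔ.supportFn_nonneg i s)] at h1
      exact (mul_eq_zero.1 (h1 s hs)).resolve_left h0

variable (hSL : (S : Set (Module.Dual ℝ V)) ⊆ dualLattice L)
include hSL

lemma supportFn_eq_zero_of_ne {s : Module.Dual ℝ V} (hs : s ∈ S) {i j : ι} (hij : i ≠ j)
    (hi : supportFn (Δ i) s ≠ 0) : supportFn (Δ j) s = 0 := by
  classical
  obtain ⟨m, hm⟩ := hΔ.exists_supportFn_eq_intCast i (hSL hs)
  obtain ⟨n, hn⟩ := hΔ.exists_supportFn_eq_intCast j (hSL hs)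
  have hsum : supportFn (Δ i) s + supportFn (Δ j) s ≤ 1 := by
    rw [← Finset.sum_pair (f := fun k => supportFn (Δ k) s) hij]
    exact (Finset.sum_le_sum_of_subset_of_nonneg (Finset.subset_univ _)
      fun k _ _ => hΔ.supportFn_nonneg k s).trans (hΔ.sum_supportFn_le_one hS hs)
  have h1 := hΔ.supportFn_nonneg i s
  have h2 := hΔ.supportFn_nonneg j s
  rw [hm] at hi h1 hsum
  rw [hn] at h2 hsum ⊢
  norm_cast at *
  omega

end IsCenteredNefPartition

end NefPartition

/-! ### Reflexivity, Boolean operations and the direct sum -/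

section Decomposition

variable {V : Type*} [NormedAddCommGroup V] [NormedSpace ℝ V]
variable {ι : Type*} {L : Submodule ℤ V} {Δ : ι → Set V}

lemma IsLatticePolytope.partialSum {J : Finset ι} (h : ∀ j, IsLatticePolytope L (Δ j)) :
    IsLatticePolytope L (partialSum Δ J) := by
  classical
  choose T hTL hT using h
  refine ⟨∑ j ∈ J, T j, ?_, ?_⟩
  · intro x hx
    rw [Finset.coe_sum, Set.mem_finsetSum] at hx
    obtain ⟨g, hg, rfl⟩ := hx
    exact sum_mem fun j hj => hTL j (hg hj)
  · rw [Finset.coe_sum, convexHull_sum]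
    exact Finset.sum_congr rfl fun j _ => hT j

lemma IsLatticePolytope.preimage_span {P : Set V} (hP : IsLatticePolytope L P) :
    IsLatticePolytope (latticeIn L (Submodule.span ℝ P))
      ((↑) ⁻¹' P : Set (Submodule.span ℝ P)) := by
  classical
  set U := Submodule.span ℝ P with hU
  obtain ⟨T, hTL, hT⟩ := hP
  have hTU : (T : Set V) ⊆ U :=
    (subset_convexHull ℝ _).trans (hT ▸ Submodule.subset_span)
  have himage : U.subtype '' (U.subtype ⁻¹' T) = T := by
    rw [Set.image_preimage_eq_inter_range, Set.inter_eq_left]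
    simpa using hTU
  have hfin : (U.subtype ⁻¹' (T : Set V)).Finite :=
    T.finite_toSet.preimage U.injective_subtype.injOn
  refine ⟨hfin.toFinset, ?_, ?_⟩
  · intro x hx
    exact hTL (by simpa using hx)
  · rw [hfin.coe_toFinset]
    apply Set.image_injective.2 U.injective_subtype
    rw [LinearMap.image_convexHull, himage, ← hT]
    change U.subtype '' (U.subtype ⁻¹' P) = P
    rw [Set.image_preimage_eq_inter_range, Set.inter_eq_left]
    rw [← LinearMap.coe_range, Submodule.range_subtype]
    exact Submodule.subset_span

variable [Fintype ι]

namespace IsCenteredNefPartition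

variable (hΔ : IsCenteredNefPartition L Δ)
include hΔ

lemma zero_mem_interior_of_isCentered [FiniteDimensional ℝ V] {J : Finset ι}
    (hJ : IsCentered Δ J) :
    (0 : Submodule.span ℝ (partialSum Δ J)) ∈
      interior ((↑) ⁻¹' partialSum Δ J : Set (Submodule.span ℝ (partialSum Δ J))) := by
  obtain ⟨T, -, hT⟩ := IsLatticePolytope.preimage_span
    (IsLatticePolytope.partialSum (J := J) hΔ.isLatticePolytope)
  refine zero_mem_interior_of_forall_nonneg (hT ▸ convex_convexHull ℝ _) ?_
    (Submodule.span_span_coe_preimage) ?_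
  · refine (Set.mem_finsetSum _ _ _).2 ⟨0, fun {i} _ => hΔ.zero_mem i, by simp⟩
  · intro y hy
    obtain ⟨z, rfl⟩ := LinearMap.exists_extend y
    ext ⟨x, hx⟩
    refine apply_eq_zero_of_mem_span (hJ z fun j hj a ha => ?_) hx
    have haP := subset_partialSum hΔ.zero_mem hj ha
    exact hy ⟨a, Submodule.subset_span haP⟩ haP

lemma dualPolytope_preimage_span {J : Finset ι} (hJ : IsCentered Δ J) :
    dualPolytope ((↑) ⁻¹' partialSum Δ J : Set (Submodule.span ℝ (partialSum Δ J))) =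
      (Submodule.span ℝ (partialSum Δ J)).dualRestrict ''
        dualPolytope (partialSum Δ Finset.univ) := by
  classical
  obtain ⟨S, hSL, hS⟩ := hΔ.isReflexive.isLatticePolytope_dual
  apply Set.Subset.antisymm
  · intro u hu
    obtain ⟨y, rfl⟩ := LinearMap.exists_extend u
    have hy : y ∈ dualPolytope (partialSum Δ J) :=
      fun x hx => hu ⟨x, Submodule.subset_span hx⟩ hx
    rw [hΔ.mem_dualPolytope_partialSum_iff] at hy
    obtain ⟨w, hw, hwy, hsup⟩ := hΔ.exists_supportFn_eq_sum hS y
    -- The discarded generators vanish on the span since `J` is centered; the kept ones have `h_i =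
    -- 0` for `i ∉ J`, so the truncated form lies in the full dual polytope.
    set S' := S.filter fun s => ∃ j ∈ J, supportFn (Δ j) s ≠ 0
    have hS'S : S' ⊆ S := Finset.filter_subset _ _
    refine ⟨∑ s ∈ S', w s • s, ?_, ?_⟩
    · rw [hΔ.mem_dualPolytope_partialSum_iff]
      calc ∑ i, supportFn (Δ i) (∑ s ∈ S', w s • s)
          ≤ ∑ i, ∑ s ∈ S', w s * supportFn (Δ i) s :=
            Finset.sum_le_sum fun i _ => hΔ.supportFn_sum_le i S' fun s hs => hw s (hS'S hs)
        _ = ∑ j ∈ J, ∑ s ∈ S', w s * supportFn (Δ j) s := by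
            refine (Finset.sum_subset (Finset.subset_univ J) fun i _ hi => ?_).symm
            refine Finset.sum_eq_zero fun s hs => ?_
            obtain ⟨hsS, j, hj, hjs⟩ := Finset.mem_filter.1 hs
            rw [hΔ.supportFn_eq_zero_of_ne hS hSL hsS (ne_of_mem_of_not_mem hj hi) hjs, mul_zero]
        _ ≤ ∑ j ∈ J, ∑ s ∈ S, w s * supportFn (Δ j) s :=
            Finset.sum_le_sum fun j _ => Finset.sum_le_sum_of_subset_of_nonneg hS'S
              fun s hs _ => mul_nonneg (hw s hs) (hΔ.supportFn_nonneg j s)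
        _ = ∑ j ∈ J, supportFn (Δ j) y := Finset.sum_congr rfl fun j _ => (hsup j).symm
        _ ≤ 1 := hy
    · ext ⟨x, hx⟩
      change (∑ s ∈ S', w s • s) x = y x
      rw [← hwy, LinearMap.sum_apply, LinearMap.sum_apply]
      refine Finset.sum_subset hS'S fun s hs hs' => ?_
      have hzero : ∀ j ∈ J, supportFn (Δ j) s = 0 := by
        intro j hj
        by_contra hne
        exact hs' (Finset.mem_filter.2 ⟨hs, j, hj, hne⟩)
      rw [LinearMap.smul_apply,
        apply_eq_zero_of_mem_span ((hΔ.isCentered_iff hS).1 hJ s hs hzero) hx, smul_zero]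
  · rintro _ ⟨y, hy, rfl⟩ x hx
    exact hy x (partialSum_subset_partialSum hΔ.zero_mem (Finset.subset_univ J) hx)

/-- `Δ^J` is reflexive in its linear span as soon as `0` is in its relative interior. -/
lemma isReflexiveInSpan_iff [FiniteDimensional ℝ V] {J : Finset ι} :
    IsReflexiveInSpan L (partialSum Δ J) ↔ IsCentered Δ J := by
  classical
  refine ⟨fun h => h.isCentered hΔ.zero_mem, fun hJ => ?_⟩
  refine ⟨(IsLatticePolytope.partialSum hΔ.isLatticePolytope).preimage_span,
    hΔ.zero_mem_interior_of_isCentered hJ, ?_⟩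
  rw [hΔ.dualPolytope_preimage_span hJ]
  obtain ⟨S, hSL, hS⟩ := hΔ.isReflexive.isLatticePolytope_dual
  refine ⟨S.image (Submodule.span ℝ (NefPartition.partialSum Δ J)).dualRestrict, ?_, ?_⟩
  · intro u hu
    obtain ⟨s, hs, rfl⟩ := Finset.mem_image.1 hu
    exact fun x hx => hSL hs x hx
  · rw [hS, LinearMap.image_convexHull, Finset.coe_image]

lemma isCentered_inter [DecidableEq ι] {I J : Finset ι} (hI : IsCentered Δ I)
    (hJ : IsCentered Δ J) : IsCentered Δ (I ∩ J) := by
  obtain ⟨S, hSL, hS⟩ := hΔ.isReflexive.isLatticePolytope_dual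
  rw [hΔ.isCentered_iff hS] at hI hJ ⊢
  intro s hs hzero k hk
  obtain ⟨hkI, hkJ⟩ := Finset.mem_inter.1 hk
  by_cases h : ∀ i ∈ I, supportFn (Δ i) s = 0
  · exact hI s hs h k hkI
  · push Not at h
    obtain ⟨i, hiI, hi⟩ := h
    refine hJ s hs (fun j hj => ?_) k hkJ
    by_cases hij : i = j
    · exact hzero j (Finset.mem_inter.2 ⟨hij ▸ hiI, hj⟩)
    · exact hΔ.supportFn_eq_zero_of_ne hS hSL hs hij hi

lemma isCentered_compl [DecidableEq ι] {J : Finset ι} (hJ : IsCentered Δ J) :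
    IsCentered Δ Jᶜ := by
  classical
  obtain ⟨S, hSL, hS⟩ := hΔ.isReflexive.isLatticePolytope_dual
  rw [hΔ.isCentered_iff hS] at hJ ⊢
  -- Expanding minus the sum of `S` gives a linear relation on `S` with all coefficients at least 1.
  obtain ⟨w, hw, hwy, -⟩ := hΔ.exists_supportFn_eq_sum hS (-∑ s ∈ S, s)
  have hrel : ∑ s ∈ S, (w s + 1) • s = 0 := by
    simp only [add_smul, one_smul, Finset.sum_add_distrib, hwy, neg_add_cancel]
  set p : Module.Dual ℝ V → Prop := fun s => ∃ j ∈ J, supportFn (Δ j) s ≠ 0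
  have hnonneg : ∀ k ∉ J, ∀ x ∈ Δ k, ∀ s ∈ S.filter p, 0 ≤ ((w s + 1) • s) x := by
    intro k hk x hx s hs
    obtain ⟨hsS, j, hj, hjs⟩ := Finset.mem_filter.1 hs
    have h0 := hΔ.supportFn_eq_zero_of_ne hS hSL hsS (ne_of_mem_of_not_mem hj hk) hjs
    exact mul_nonneg (by linarith [hw s hsS]) (hΔ.supportFn_eq_zero_iff.1 h0 x hx)
  -- On `Δ k` with `k ∈ J` the other half of the relation vanishes; for `k ∉ J` every summand is
  -- nonnegative.
  have hzero : ∑ s ∈ S.filter p, (w s + 1) • s = 0 := by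
    refine hΔ.eq_zero_of_nonneg fun k x hx => ?_
    by_cases hk : k ∈ J
    · rw [← Finset.sum_filter_add_sum_filter_not S p] at hrel
      rw [eq_neg_of_add_eq_zero_left hrel, LinearMap.neg_apply, LinearMap.sum_apply,
        Finset.sum_eq_zero, neg_zero]
      intro s hs
      obtain ⟨hsS, hps⟩ := Finset.mem_filter.1 hs
      rw [LinearMap.smul_apply, hJ s hsS (fun j hj => ?_) k hk x hx, smul_zero]
      by_contra hne
      exact hps ⟨j, hj, hne⟩
    · rw [LinearMap.sum_apply]
      exact Finset.sum_nonneg (hnonneg k hk x hx)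
  intro s hs hsJ k hk x hx
  by_cases hps : p s
  · have h1 := LinearMap.congr_fun hzero x
    rw [LinearMap.sum_apply, LinearMap.zero_apply, Finset.sum_eq_zero_iff_of_nonneg
      (hnonneg k (Finset.mem_compl.1 hk) x hx)] at h1
    have h2 := h1 s (Finset.mem_filter.2 ⟨hs, hps⟩)
    exact (mul_eq_zero.1 h2).resolve_left (by linarith [hw s hs])
  · have : s = 0 := hΔ.eq_zero_of_nonneg fun i => hΔ.supportFn_eq_zero_iff.1 <| by
      by_cases hi : i ∈ J
      · by_contra hne
        exact hps ⟨i, hi, hne⟩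
      · exact hsJ i (Finset.mem_compl.2 hi)
    rw [this, LinearMap.zero_apply]

/-- Each `s ∈ S` vanishes on one of the two spans, and `S` separates points. -/
lemma disjoint_span_compl [DecidableEq ι] {J : Finset ι} (hJ : IsCentered Δ J) :
    Disjoint (Submodule.span ℝ (partialSum Δ J)) (Submodule.span ℝ (partialSum Δ Jᶜ)) := by
  have hJc := hΔ.isCentered_compl hJ
  obtain ⟨S, hSL, hS⟩ := hΔ.isReflexive.isLatticePolytope_dual
  rw [hΔ.isCentered_iff hS] at hJ hJc
  rw [Submodule.disjoint_def]
  intro x hx hxc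
  refine hΔ.eq_zero_of_forall_apply_eq_zero hS fun s hs => ?_
  by_cases h : ∀ j ∈ J, supportFn (Δ j) s = 0
  · exact apply_eq_zero_of_mem_span (hJ s hs h) hx
  · push Not at h
    obtain ⟨j, hj, hjs⟩ := h
    exact apply_eq_zero_of_mem_span (hJc s hs fun k hk => hΔ.supportFn_eq_zero_of_ne hS hSL hs
      (ne_of_mem_of_not_mem hj (Finset.mem_compl.1 hk)) hjs) hxc

lemma span_partialSum_univ : Submodule.span ℝ (partialSum Δ Finset.univ) = ⊤ := by
  by_contra hne
  obtain ⟨y, hy, hle⟩ := Submodule.exists_le_ker_of_lt_top _ (lt_top_iff_ne_top.2 hne)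
  exact hy (hΔ.eq_zero_of_nonneg fun j x hx => (LinearMap.mem_ker.1 (hle (Submodule.subset_span
    (subset_partialSum hΔ.zero_mem (Finset.mem_univ j) hx)))).ge)

lemma isInternal_span [DecidableEq ι] (D : Finpartition (Finset.univ : Finset ι))
    (hD : ∀ I ∈ D.parts, IsCentered Δ I) : DirectSum.IsInternal
      (fun I : D.parts => Submodule.span ℝ (partialSum Δ (I : Finset ι))) := by
  rw [DirectSum.isInternal_submodule_iff_iSupIndep_and_iSup_eq_top]
  constructor
  · rintro ⟨I, hI⟩
    refine (hΔ.disjoint_span_compl (hD I hI)).mono_right ?_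
    refine iSup₂_le fun J hJ => Submodule.span_mono
      (partialSum_subset_partialSum hΔ.zero_mem ?_)
    rw [Finset.subset_compl_iff_disjoint_right]
    exact D.disjoint J.2 hI fun h => hJ (Subtype.ext h)
  · rw [eq_top_iff, ← hΔ.span_partialSum_univ, Submodule.span_le]
    intro x hx
    obtain ⟨g, hg, rfl⟩ := (Set.mem_finsetSum _ _ _).1 hx
    refine sum_mem fun i hi => ?_
    obtain ⟨I, hI, hiI⟩ := D.exists_mem hi
    exact Submodule.mem_iSup_of_mem (⟨I, hI⟩ : D.parts)
      (Submodule.subset_span (subset_partialSum hΔ.zero_mem hiI (hg hi)))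

variable [FiniteDimensional ℝ V]

lemma isIrreducibleSubset_iff {I : Finset ι} :
    IsIrreducibleSubset L Δ I ↔ Minimal (fun J : Finset ι => J.Nonempty ∧ IsCentered Δ J) I := by
  simp only [IsIrreducibleSubset, hΔ.isReflexiveInSpan_iff]

variable [DecidableEq ι]

lemma eq_of_isIrreducibleSubset_of_mem {I J : Finset ι} (hI : IsIrreducibleSubset L Δ I)
    (hJ : IsIrreducibleSubset L Δ J) {a : ι} (haI : a ∈ I) (haJ : a ∈ J) : I = J :=
  eq_of_minimal_of_mem (fun _ _ => hΔ.isCentered_inter) (hΔ.isIrreducibleSubset_iff.1 hI)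
    (hΔ.isIrreducibleSubset_iff.1 hJ) haI haJ

lemma exists_finpartition : ∃ D : Finpartition (Finset.univ : Finset ι),
    ∀ I, I ∈ D.parts ↔ IsIrreducibleSubset L Δ I := by
  classical
  refine ⟨Finpartition.ofExistsUnique (Finset.univ.filter (IsIrreducibleSubset L Δ))
    (fun _ _ => Finset.subset_univ _) (fun a _ => ?_) ?_,
    fun I => Finset.mem_filter.trans (and_iff_right (Finset.mem_univ I))⟩
  · obtain ⟨I, hI, haI⟩ := exists_minimal_mem hΔ.isCentered_univ
      (fun _ _ => hΔ.isCentered_inter) (fun _ => hΔ.isCentered_compl) a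
    rw [← hΔ.isIrreducibleSubset_iff] at hI
    refine ⟨I, ⟨by simpa using hI, haI⟩, ?_⟩
    rintro J ⟨hJ, haJ⟩
    exact hΔ.eq_of_isIrreducibleSubset_of_mem (by simpa using hJ) hI haJ haI
  · intro h
    exact Finset.not_nonempty_empty (Finset.mem_filter.1 h).2.prop.1

lemma isIrreducibleDecomposition (D : Finpartition (Finset.univ : Finset ι))
    (hD : ∀ I ∈ D.parts, IsIrreducibleSubset L Δ I) : IsIrreducibleDecomposition L Δ D where
  irreducible := hD
  sum_eq := by
    have h := Finset.sum_biUnion (f := Δ) (t := id) D.supIndep.pairwiseDisjoint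
    rwa [D.biUnion_parts] at h
  isInternal := hΔ.isInternal_span D fun I hI => (hΔ.isIrreducibleSubset_iff.1 (hD I hI)).prop.2

end IsCenteredNefPartition

end Decomposition

end NefPartition

theorem mainTheorem8 {V : Type*} [NormedAddCommGroup V] [NormedSpace ℝ V] [FiniteDimensional ℝ V]
    (L : Submodule ℤ V) [DiscreteTopology L] [IsZLattice ℝ L]
    {r : ℕ} (Δ : Fin r → Set V)
    (hΔ : NefPartition.IsCenteredNefPartition L Δ) (hproper : NefPartition.IsProper Δ) :
    (∀ I I' : Finset (Fin r), NefPartition.IsIrreducibleSubset L Δ I →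
      NefPartition.IsIrreducibleSubset L Δ I' → I ≠ I' → Disjoint I I') ∧
    ∃ D : Finpartition (Finset.univ : Finset (Fin r)),
      NefPartition.IsIrreducibleDecomposition L Δ D ∧
      ∀ E : Finpartition (Finset.univ : Finset (Fin r)),
        (∀ I ∈ E.parts, NefPartition.IsIrreducibleSubset L Δ I) → E = D := by
  refine ⟨fun I I' hI hI' hne => ?_, ?_⟩
  · rw [Finset.disjoint_left]
    exact fun a haI haI' => hne (hΔ.eq_of_isIrreducibleSubset_of_mem hI hI' haI haI')
  · obtain ⟨D, hD⟩ := hΔ.exists_finpartition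
    refine ⟨D, hΔ.isIrreducibleDecomposition D fun I => (hD I).1, fun E hE => ?_⟩
    apply Finpartition.ext
    ext I
    refine ⟨fun hI => (hD I).2 (hE I hI), fun hI => ?_⟩
    rw [hD] at hI
    obtain ⟨a, ha⟩ := hI.prop.1
    obtain ⟨J, hJ, haJ⟩ := E.exists_mem (Finset.mem_univ a)
    rwa [hΔ.eq_of_isIrreducibleSubset_of_mem hI (hE J hJ) ha haJ]
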